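/- Let $f : X \times Y \to \{0,1\}$. A one-way (private-coin) protocol of cost $c$ for $f$ works as follows: Alice, on input $x \in X$, draws a random message $m \in \{0,1\}^c$ from a distribution depending only on $x$ and sends it to Bob; Bob, on input $y \in Y$, outputs a random bit drawn from a distribution depending only on $m$ and $y$ (there is no shared randomness). The complexity $R^1(f)$ is the minimum cost $c$ of such a protocol for which, for all $(x,y)$, Bob outputs $f(x,y)$ with probability at least $2/3$ (that is, with completeness and soundness error $1/3$). For a finite group $G$, let $\mathrm{MEMB}_G$ be the function with $\mathrm{MEMB}_G(H,y) = 1$ if $y \in H$ and $\mathrm{MEMB}_G(H,y) = 0$ if $y \notin H$, where $H$ ranges over the subgroups of $G$ (Alice's input) and $y$ over the elements of $G$ (Bob's input). **Corollary.** For every natural number $k$ there is a constant $C$, depending only on $k$, such that every finite group $G$ that possesses an abelian subgroup of index at most $k$ satisfies $$R^1(\mathrm{MEMB}_G) \le C \log_2 |G|.$$ That is, $R^1(\mathrm{MEMB}_G) = O(\log |G|)$ over any family of finite groups each possessing an abelian subgroup of constant (bounded) index. -/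

import Mathlib

/-- A one-way private-coin randomized protocol with `c` bits of communication, for Alice's inputs
in `X` and Bob's inputs in `Y`. On input `x` Alice draws a message of `c` bits; on receiving the
message `m`, Bob, who holds `y`, draws his output bit. There is no shared randomness. -/
structure OneWayProtocol (X Y : Type*) (c : ℕ) where
  alice : X → PMF (Fin c → Bool)
  bob : (Fin c → Bool) → Y → PMF Bool

namespace OneWayProtocol

variable {X Y : Type*} {c : ℕ}

/-- The distribution of Bob's output bit on inputs `x` and `y`. -/
noncomputable def output (P : OneWayProtocol X Y c) (x : X) (y : Y) : PMF Bool :=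
  (P.alice x).bind fun m => P.bob m y

/-- `P` is a protocol for `f` with completeness error `ε` and soundness error `δ`. -/
def Computes (P : OneWayProtocol X Y c) (f : X → Y → Bool) (ε δ : ℝ) : Prop :=
  (∀ x y, f x y = true → 1 - ε ≤ (P.output x y true).toReal) ∧
  (∀ x y, f x y = false → 1 - δ ≤ (P.output x y false).toReal)

end OneWayProtocol

/-- The one-way classical bounded-error communication complexity `R¹(f)`: the minimum cost of a
protocol for `f` with completeness and soundness error `1/3` (`⊤` if there is no protocol). -/
noncomputable def oneWayComplexity {X Y : Type*} (f : X → Y → Bool) : ℕ∞ :=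
  ⨅ (c : ℕ) (_ : ∃ P : OneWayProtocol X Y c, P.Computes f (1 / 3) (1 / 3)), (c : ℕ∞)

open Classical in
/-- The subgroup membership function `MEMB_G`. -/
noncomputable def memb (G : Type*) [Group G] (H : Subgroup G) (y : G) : Bool :=
  decide (y ∈ H)

/-!
Let `A` be an abelian subgroup of `G` of index at most `k`, and let Alice hold the subgroup `H`.
Each left coset `q` of `A` that meets `H` meets it in a single coset `h * (H ⊓ A)`, so `H` is
determined by `H ⊓ A` together with one representative `h` for each such `q`. Alice sends these
representatives (at most `k` elements of `G`), which leaves Bob, who holds `y`, with the question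
whether `h⁻¹ * y`, an element of `A`, lies in `H ⊓ A`.

This is a membership problem in the finite abelian group `A`, and it is solved by characters: Alice
also sends two independent uniformly random characters of `A` that are trivial on `H ⊓ A`, and Bob
accepts if both are trivial at `h⁻¹ * y`. Elements of `H ⊓ A` always pass. An element of `A` outside
`H ⊓ A` is separated from it by some character, so the characters that fail to detect it form a
proper subgroup (`two_mul_card_annihilator_apply_eq_one_le`), and it passes with probability at
most `1/4`. As `A` has `Nat.card A` characters, there are at most `Nat.card G ^ (k + 2)` messages.
-/

/-! ### Protocols from uniform randomness -/

/-- A protocol in which Alice encodes a uniformly random element of the finite type `R x` and Bob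
answers deterministically. The messages may come from any finite type `M` with at most `2 ^ c`
elements. -/
theorem OneWayProtocol.exists_computes_of_uniform {X Y M : Type*} {R : X → Type*} [Finite M]
    [∀ x, Finite (R x)] [∀ x, Nonempty (R x)] {c : ℕ} (hM : Nat.card M ≤ 2 ^ c)
    (f : X → Y → Bool) (enc : ∀ x, R x → M) (dec : M → Y → Bool)
    (herr : ∀ x y, 3 * Nat.card {r : R x // dec (enc x r) y ≠ f x y} ≤ Nat.card (R x)) :
    ∃ P : OneWayProtocol X Y c, P.Computes f (1 / 3) (1 / 3) := by
  classical
  have _ := Fintype.ofFinite M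
  have _ : ∀ x, Fintype (R x) := fun x => Fintype.ofFinite (R x)
  obtain ⟨e⟩ : Nonempty (M ↪ (Fin c → Bool)) := by
    apply Function.Embedding.nonempty_of_card_le
    simpa [Nat.card_eq_fintype_card] using hM
  rcases isEmpty_or_nonempty X with hX | ⟨⟨x₀⟩⟩
  · exact ⟨⟨fun x => isEmptyElim x, fun _ _ => PMF.pure true⟩,
      fun x => isEmptyElim x, fun x => isEmptyElim x⟩
  have _ : Nonempty M := (inferInstance : Nonempty (R x₀)).map (enc x₀)
  let P : OneWayProtocol X Y c :=
    { alice := fun x => (PMF.uniformOfFintype (R x)).map fun r => e (enc x r)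
      bob := fun m y => PMF.pure (dec (Function.invFun e m) y) }
  have hout : ∀ x y, P.output x y =
      (PMF.uniformOfFintype (R x)).map fun r => dec (enc x r) y := by
    intro x y
    simp only [OneWayProtocol.output, P, PMF.bind_map]
    rw [← PMF.bind_pure_comp]
    congr 1
    funext r
    simp [Function.leftInverse_invFun e.injective (enc x r)]
  have hprob : ∀ x y, (1 : ℝ) - 1 / 3 ≤ (P.output x y (f x y)).toReal := by
    intro x y
    have hval : P.output x y (f x y) =
        (Fintype.card {r : R x // dec (enc x r) y = f x y} : ENNReal) / Fintype.card (R x) := by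
      rw [hout, ← PMF.toOuterMeasure_apply_singleton, PMF.toOuterMeasure_map_apply,
        PMF.toOuterMeasure_uniformOfFintype_apply]
      congr 2
      exact Fintype.card_congr (Equiv.refl _)
    have hsplit := Fintype.card_subtype_compl fun r : R x => dec (enc x r) y = f x y
    have hle := Fintype.card_subtype_le fun r : R x => dec (enc x r) y = f x y
    have h3 := herr x y
    simp only [Nat.card_eq_fintype_card, ne_eq] at h3
    have hpos : 0 < Fintype.card (R x) := Fintype.card_pos
    rw [hval, ENNReal.toReal_div, ENNReal.toReal_natCast, ENNReal.toReal_natCast,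
      le_div_iff₀ (by exact_mod_cast hpos)]
    have h2 : 2 * Fintype.card (R x) ≤
        3 * Fintype.card {r : R x // dec (enc x r) y = f x y} := by omega
    have h2' : (2 : ℝ) * Fintype.card (R x) ≤
        3 * Fintype.card {r : R x // dec (enc x r) y = f x y} := by exact_mod_cast h2
    linarith
  exact ⟨P, fun x y h => h ▸ hprob x y, fun x y h => h ▸ hprob x y⟩

theorem oneWayComplexity_eq_natCast_of_computes {X Y : Type*} {f : X → Y → Bool} {c : ℕ}
    (h : ∃ P : OneWayProtocol X Y c, P.Computes f (1 / 3) (1 / 3)) :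
    ∃ n : ℕ, oneWayComplexity f = (n : ℕ∞) ∧ n ≤ c := by
  have hle : oneWayComplexity f ≤ (c : ℕ∞) := iInf₂_le c h
  obtain ⟨n, hn⟩ := ENat.ne_top_iff_exists.mp (ne_top_of_le_ne_top (ENat.natCast_ne_top c) hle)
  exact ⟨n, hn.symm, by exact_mod_cast hn ▸ hle⟩

/-! ### Characters trivial on a subgroup -/

/-- The group of complex characters of `A` that are trivial on the subgroup `K`. -/
def characterAnnihilator {A : Type*} [CommGroup A] (K : Subgroup A) : Subgroup (A →* ℂˣ) :=
  (MonoidHom.domRestrictHom K ℂˣ).ker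

theorem apply_eq_one_of_mem_characterAnnihilator {A : Type*} [CommGroup A] {K : Subgroup A}
    {χ : A →* ℂˣ} (hχ : χ ∈ characterAnnihilator K) {a : A} (ha : a ∈ K) : χ a = 1 :=
  DFunLike.congr_fun (MonoidHom.mem_ker.mp hχ) ⟨a, ha⟩

/-- A random character trivial on `K` detects an element outside `K` with probability at least
one half: those that fail to do so are the kernel of a nontrivial evaluation map. -/
theorem two_mul_card_annihilator_apply_eq_one_le {A : Type*} [CommGroup A] [Finite A]
    {K : Subgroup A} {a : A} (ha : a ∉ K) :
    2 * Nat.card {χ : characterAnnihilator K // χ.1 a = 1} ≤ Nat.card (characterAnnihilator K) := by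
  let ev : characterAnnihilator K →* ℂˣ :=
    (MonoidHom.eval a).comp (characterAnnihilator K).subtype
  have hne : (QuotientGroup.mk a : A ⧸ K) ≠ 1 := by
    rwa [ne_eq, QuotientGroup.eq_one_iff]
  -- A character of `A ⧸ K` that is nontrivial at the class of `a` shows that the kernel is proper.
  obtain ⟨φ, hφ⟩ := CommGroup.exists_apply_ne_one_of_hasEnoughRootsOfUnity (A ⧸ K) ℂ hne
  have hmem : φ.comp (QuotientGroup.mk' K) ∈ characterAnnihilator K := by
    refine MonoidHom.mem_ker.mpr (MonoidHom.ext fun b => ?_)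
    have hb : (QuotientGroup.mk (b : A) : A ⧸ K) = 1 := (QuotientGroup.eq_one_iff _).mpr b.2
    simp [MonoidHom.domRestrictHom, hb]
  have hker : ev.ker ≠ ⊤ := by
    intro h
    have : (⟨_, hmem⟩ : characterAnnihilator K) ∈ ev.ker := h ▸ Subgroup.mem_top _
    exact hφ (MonoidHom.mem_ker.mp this)
  have hindex : 2 ≤ ev.ker.index := by
    have h0 : ev.ker.index ≠ 0 := Subgroup.index_ne_zero_of_finite
    have h1 : ev.ker.index ≠ 1 := fun h => hker (Subgroup.index_eq_one.mp h)
    omega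
  have hcard : Nat.card {χ : characterAnnihilator K // χ.1 a = 1} = Nat.card ev.ker := rfl
  rw [hcard, ← ev.ker.card_mul_index, mul_comm]
  exact Nat.mul_le_mul_left _ hindex

/-! ### Membership with respect to an abelian subgroup -/

open Classical in
/-- An element of `H` in the left coset `q` of `A`, or `1` if there is none. The default value is
again in `H`, and this is all that soundness of the protocol needs: for `s ∈ H`, any `y` with
`s⁻¹ * y ∈ H` is in `H`. -/
noncomputable def cosetRepresentative {G : Type*} [Group G] (A H : Subgroup G) (q : G ⧸ A) : G :=
  if h : ∃ g ∈ H, (g : G ⧸ A) = q then h.choose else 1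

theorem cosetRepresentative_mem {G : Type*} [Group G] (A H : Subgroup G) (q : G ⧸ A) :
    cosetRepresentative A H q ∈ H := by
  unfold cosetRepresentative
  split_ifs with h
  · exact h.choose_spec.1
  · exact H.one_mem

theorem mk_cosetRepresentative {G : Type*} [Group G] (A : Subgroup G) {H : Subgroup G} {g : G}
    (hg : g ∈ H) : ((cosetRepresentative A H (g : G ⧸ A) : G) : G ⧸ A) = g := by
  have h : ∃ g' ∈ H, (g' : G ⧸ A) = g := ⟨g, hg, rfl⟩
  rw [cosetRepresentative, dif_pos h]
  exact h.choose_spec.2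

theorem three_mul_card_subtype_le_of_forall_not {R : Type*} {p : R → Prop} (h : ∀ r, ¬p r)
    (n : ℕ) : 3 * Nat.card {r // p r} ≤ n := by
  have : IsEmpty {r // p r} := Subtype.isEmpty_of_false h
  simp

open Classical in
/-- The exponent counts one representative for each left coset of `A`, and two characters. -/
theorem exists_protocol_memb {G : Type*} [Group G] [Finite G] (A : Subgroup G)
    (hA : ∀ a ∈ A, ∀ b ∈ A, a * b = b * a) {c : ℕ} (hc : Nat.card G ^ (A.index + 2) ≤ 2 ^ c) :
    ∃ P : OneWayProtocol (Subgroup G) G c, P.Computes (memb G) (1 / 3) (1 / 3) := by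
  let _ : CommGroup A :=
    { (inferInstance : Group A) with
      mul_comm := fun a b => Subtype.ext (hA a a.2 b b.2) }
  have hchar : Nat.card (A →* ℂˣ) ≤ Nat.card G :=
    (CommGroup.card_monoidHom_of_hasEnoughRootsOfUnity A ℂ).trans_le (Subgroup.card_le_card_group A)
  refine OneWayProtocol.exists_computes_of_uniform
    (M := (G ⧸ A → G) × (A →* ℂˣ) × (A →* ℂˣ))
    (R := fun H => characterAnnihilator (H.subgroupOf A) × characterAnnihilator (H.subgroupOf A))
    ?_ (memb G) (fun H r => (cosetRepresentative A H, r.1, r.2))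
    (fun m y => decide (∃ h : (m.1 y)⁻¹ * y ∈ A, m.2.1 ⟨_, h⟩ = 1 ∧ m.2.2 ⟨_, h⟩ = 1)) ?_
  · refine le_trans ?_ hc
    rw [Nat.card_prod, Nat.card_prod, Nat.card_fun, pow_add, sq]
    exact Nat.mul_le_mul_left _ (Nat.mul_le_mul hchar hchar)
  intro H y
  set s := cosetRepresentative A H (y : G ⧸ A) with hs
  have hsH : s ∈ H := cosetRepresentative_mem A H _
  by_cases hy : y ∈ H
  · have hsA : s⁻¹ * y ∈ A := QuotientGroup.eq.mp (mk_cosetRepresentative A hy)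
    have hK : (⟨_, hsA⟩ : A) ∈ H.subgroupOf A := H.mul_mem (H.inv_mem hsH) hy
    refine three_mul_card_subtype_le_of_forall_not (fun r => not_not.mpr ?_) _
    have hr : ∃ h : s⁻¹ * y ∈ A, r.1.1 ⟨_, h⟩ = 1 ∧ r.2.1 ⟨_, h⟩ = 1 :=
      ⟨hsA, apply_eq_one_of_mem_characterAnnihilator r.1.2 hK,
        apply_eq_one_of_mem_characterAnnihilator r.2.2 hK⟩
    simpa [memb, hy] using hr
  · by_cases hsA : s⁻¹ * y ∈ A
    · have hK : (⟨_, hsA⟩ : A) ∉ H.subgroupOf A := by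
        intro h
        have : s * (s⁻¹ * y) ∈ H := H.mul_mem hsH h
        exact hy (by simpa using this)
      have hhalf := two_mul_card_annihilator_apply_eq_one_le hK
      -- Both characters have to miss `s⁻¹ * y`, so at most a quarter of the pairs err.
      set D := characterAnnihilator (H.subgroupOf A)
      have hle : Nat.card {r : D × D //
          decide (∃ h : s⁻¹ * y ∈ A, r.1.1 ⟨_, h⟩ = 1 ∧ r.2.1 ⟨_, h⟩ = 1) ≠ memb G H y} ≤
          Nat.card ({χ : D // χ.1 ⟨_, hsA⟩ = 1} × {χ : D // χ.1 ⟨_, hsA⟩ = 1}) := by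
        have hpass : ∀ r : {r : D × D //
            decide (∃ h : s⁻¹ * y ∈ A, r.1.1 ⟨_, h⟩ = 1 ∧ r.2.1 ⟨_, h⟩ = 1) ≠ memb G H y},
            r.1.1.1 ⟨_, hsA⟩ = 1 ∧ r.1.2.1 ⟨_, hsA⟩ = 1 := by
          rintro ⟨r, hr⟩
          simpa [memb, hy, hsA] using hr
        refine Nat.card_le_card_of_injective
          (fun r => (⟨r.1.1, (hpass r).1⟩, ⟨r.1.2, (hpass r).2⟩)) fun r r' h => ?_
        simp only [Prod.mk.injEq, Subtype.mk.injEq] at h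
        exact Subtype.ext (Prod.ext h.1 h.2)
      rw [Nat.card_prod] at hle ⊢
      refine (Nat.mul_le_mul_left 3 hle).trans ?_
      nlinarith
    · refine three_mul_card_subtype_le_of_forall_not (fun r => not_not.mpr ?_) _
      have hr : ¬∃ h : s⁻¹ * y ∈ A, r.1.1 ⟨_, h⟩ = 1 ∧ r.2.1 ⟨_, h⟩ = 1 := fun h => hsA h.1
      simpa [memb, hy] using hr

theorem Nat.clog_two_le_two_mul_logb {n : ℕ} (hn : n ≠ 0) :
    (Nat.clog 2 n : ℝ) ≤ 2 * Real.logb 2 n := by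
  rcases (Nat.one_le_iff_ne_zero.mpr hn).eq_or_lt with rfl | h
  · simp
  -- For `n ≥ 2` the logarithm is at least `1`, which absorbs the rounding.
  have hlog : (1 : ℝ) ≤ Real.logb 2 n := by
    rw [Real.le_logb_iff_rpow_le one_lt_two (by positivity)]
    simpa using (show (2 : ℝ) ≤ n by exact_mod_cast h)
  have hceil := Nat.ceil_lt_add_one (zero_le_one.trans hlog)
  have heq : ⌈Real.logb 2 n⌉₊ = Nat.clog 2 n := by
    exact_mod_cast Real.natCeil_logb_natCast 2 n
  rw [heq] at hceil
  linarith

theorem mainTheorem7 :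
    ∀ k : ℕ, ∃ C : ℝ, ∀ (G : Type*) [Group G] [Finite G],
      (∃ A : Subgroup G, (∀ a ∈ A, ∀ b ∈ A, a * b = b * a) ∧ A.index ≤ k) →
        ∃ n : ℕ, oneWayComplexity (memb G) = (n : ℕ∞) ∧
          (n : ℝ) ≤ C * Real.logb 2 (Nat.card G) := by
  intro k
  refine ⟨2 * (k + 2), fun G _ _ ⟨A, hA, hk⟩ => ?_⟩
  have hcost : Nat.card G ^ (A.index + 2) ≤ 2 ^ (Nat.clog 2 (Nat.card G) * (k + 2)) := by
    rw [pow_mul]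
    exact (Nat.pow_le_pow_right Nat.card_pos (by omega)).trans
      (Nat.pow_le_pow_left (Nat.le_pow_clog one_lt_two _) _)
  obtain ⟨n, hn, hnc⟩ := oneWayComplexity_eq_natCast_of_computes (exists_protocol_memb A hA hcost)
  refine ⟨n, hn, ?_⟩
  have hclog := Nat.clog_two_le_two_mul_logb (n := Nat.card G) Nat.card_pos.ne'
  calc (n : ℝ) ≤ Nat.clog 2 (Nat.card G) * (k + 2) := by exact_mod_cast hnc
    _ ≤ 2 * Real.logb 2 (Nat.card G) * (k + 2) := by gcongr
    _ = 2 * (k + 2) * Real.logb 2 (Nat.card G) := by ring
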